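/- **Proposition 6.1.** Let $N\ge 0$ be an integer and $\hbar\in\mathbb R\setminus\{0\}$. Let $E_{jk}$ be the matrix units of $\mathfrak{gl}(N)$, and put $\rho^{(n)}_k=\frac12(n-2k+1)$ for $1\le k\le n$. *Representation theory side.* Let $V'$ and $V$ be complex $\mathfrak{gl}(N)$-modules with a pairing $\langle\cdot,\cdot\rangle:V'\times V\to\mathbb C$, conjugate linear in the first and linear in the second variable, such that $\langle Xv',v\rangle=-\langle v',Xv\rangle$ for all $X\in\mathfrak{gl}(N,\mathbb R)$, $v'\in V'$, $v\in V$. Assume that the action of the Cartan subalgebra on $V$ is integrated to the Cartan torus: there is a linear representation $t\mapsto e^{\sum_k t_kE_{kk}}$ of the additive group $\mathbb R^N$ on $V$ with $$e^{\sum_k t_kE_{kk}}\,(Xv)=\big(e^{\mathrm{diag}(t)}Xe^{-\mathrm{diag}(t)}\big)\,e^{\sum_k t_kE_{kk}}v\qquad(X\in\mathfrak{gl}(N),\ v\in V),$$ and for all $v'\in V'$, $v\in V$ the function $t\mapsto\langle v',e^{\sum_k t_kE_{kk}}v\rangle$ is differentiable at $t=0$ with differential $s\mapsto\sum_k s_k\langle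 v',E_{kk}v\rangle$. Let $w'_N\in V'$ and $w_N\in V$ be Whittaker vectors: $$E_{k+1,k}w'_N=-i\hbar^{-1}w'_N,\qquad E_{k,k+1}w_N=-i\hbar^{-1}w_N\qquad(1\le k\le N-1).$$ (No cyclicity or irreducibility of the modules and no non-degeneracy of the pairing is needed. $V$ may be larger than the module generated by $w_N$; it has to contain the vectors $e^{-\sum_k x_kE_{kk}}w_N$.) For $x\in\mathbb R^N$ define $$\psi(x)=e^{-\sum_k x_k\rho^{(N)}_k}\,\big\langle w'_N,\;e^{-\sum_k x_kE_{kk}}\,w_N\big\rangle .$$ For $0\le n\le N$ and $\mu\in\mathbb C$ let $\mathcal A_n(\mu)\in\mathcal U(\mathfrak{gl}(N))$ be the generating function of the Casimir operators of $\mathcal U(\mathfrak{gl}(n))$, $$\mathcal A_n(\mu)=\sum_{p\in P_n}\operatorname{sign}p\,\big[(\mu-i\hbar\rho^{(n)}_1)\delta_{p(1),1}-i\hbar E_{p(1),1}\big]\cdots\big[(\mu-i\hbar\rho^{(n)}_n)\delta_{p(n),n}-i\hbar E_{p(n),n}\big],$$ where $P_n$ is the group of permutations of $\{1,\dots,n\}$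 and $\mathcal A_0=1$. *Toda side.* On smooth complex-valued functions of $x_1,\dots,x_N\in\mathbb R$ let $p_k=-i\hbar\,\partial_{x_k}$ and, for $\lambda\in\mathbb C$, $$L_k(\lambda)=\begin{pmatrix}\lambda-p_k&e^{-x_k}\\-e^{x_k}&0\end{pmatrix},\qquad T_n(\lambda)=L_n(\lambda)\cdots L_1(\lambda),\qquad T_0(\lambda)=I,$$ and let $A_n(\lambda)$ be the upper left entry of $T_n(\lambda)$, a differential operator. *Claim.* The function $\psi$ is smooth on $\mathbb R^N$, and for all $0\le n\le N$, $\lambda\in\mathbb C$ and $x\in\mathbb R^N$ $$\big(A_n(\lambda)\psi\big)(x)=e^{-\sum_k x_k\rho^{(N)}_k}\,\Big\langle w'_N,\;e^{-\sum_k x_kE_{kk}}\,\mathcal A_n\!\Big(\lambda-\frac{i(N-n)\hbar}{2}\Big)w_N\Big\rangle .$$ -/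

import Mathlib

open scoped ContDiff

attribute [local instance 100] LieRing.ofAssociativeRing

/-! ### The Lie algebra `𝔤𝔩(N)`, its modules and the Casimir generating functions -/

/-- The Lie algebra `𝔤𝔩(N)` (complexification of `𝔤𝔩(N, ℝ)`), with the commutator bracket. -/
abbrev GLie (N : ℕ) : Type := Matrix (Fin N) (Fin N) ℂ

/-- The matrix units `E_{jk}`. -/
noncomputable def matUnit {N : ℕ} (j k : Fin N) : GLie N := Matrix.single j k 1

/-- The universal enveloping algebra `𝓤(𝔤𝔩(N))`. -/
abbrev UGL (N : ℕ) : Type := UniversalEnvelopingAlgebra ℂ (GLie N)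

/-- The action of `𝓤(𝔤𝔩(N))` on a `𝔤𝔩(N)`-module. -/
noncomputable def uAct {N : ℕ} {V : Type*} [AddCommGroup V] [Module ℂ V]
    [LieRingModule (GLie N) V] [LieModule ℂ (GLie N) V] : UGL N →ₐ[ℂ] Module.End ℂ V :=
  UniversalEnvelopingAlgebra.lift ℂ (LieModule.toEnd ℂ (GLie N) V)

/-- `ρ^{(n)}_k = (n - 2k + 1) / 2` for the 1-based index `k`; here `k : Fin n` is 0-based. -/
noncomputable def rho (n : ℕ) (k : Fin n) : ℝ := ((n : ℝ) - 2 * ((k : ℕ) + 1 : ℝ) + 1) / 2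

/-- The generating function of the Casimir operators of the subalgebra
`𝓤(𝔤𝔩(n)) ⊆ 𝓤(𝔤𝔩(N))` (upper left corner), the ordered column determinant
`𝓐_n(μ) = ∑_p sign p ∏_{k = 1, …, n} ((μ - iħ ρ^{(n)}_k) δ_{p(k),k} - iħ E_{p(k),k})`,
the factors being multiplied from left to right in the order `k = 1, …, n`. -/
noncomputable def casimirGen {N : ℕ} (n : ℕ) (hn : n ≤ N) (ħ : ℝ) (μ : ℂ) : UGL N :=
  ∑ p : Equiv.Perm (Fin n), ((Equiv.Perm.sign p : ℤ) : ℂ) •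
    (List.ofFn fun k : Fin n =>
      (if p k = k then algebraMap ℂ (UGL N) (μ - Complex.I * ħ * rho n k) else 0)
        - (Complex.I * ħ) •
          UniversalEnvelopingAlgebra.ι ℂ (matUnit (Fin.castLE hn (p k)) (Fin.castLE hn k))).prod

/-! ### Whittaker vectors, dual pairings, integration to the Cartan torus -/

/-- `w` is a Whittaker vector for the upper nilpotent subalgebra with character
`χ₊(E_{n,n+1}) = -i ħ⁻¹`. -/
def IsWhittakerUpper (N : ℕ) (ħ : ℝ) {V : Type*} [AddCommGroup V] [Module ℂ V]
    [LieRingModule (GLie N) V] (w : V) : Prop :=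
  ∀ j k : Fin N, (j : ℕ) + 1 = k → ⁅(matUnit j k : GLie N), w⁆ = (-Complex.I * (ħ : ℂ)⁻¹) • w

/-- `w'` is a Whittaker vector for the lower nilpotent subalgebra with character
`χ₋(E_{n+1,n}) = -i ħ⁻¹`. -/
def IsWhittakerLower (N : ℕ) (ħ : ℝ) {V : Type*} [AddCommGroup V] [Module ℂ V]
    [LieRingModule (GLie N) V] (w' : V) : Prop :=
  ∀ j k : Fin N, (j : ℕ) + 1 = k → ⁅(matUnit k j : GLie N), w'⁆ = (-Complex.I * (ħ : ℂ)⁻¹) • w'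

/-- A pairing, conjugate linear in the first and linear in the second variable, under which the
real Lie algebra `𝔤𝔩(N, ℝ)` acts by skew operators: `⟨X v', v⟩ = -⟨v', X v⟩`. -/
def IsInvariantPairing (N : ℕ) {V' V : Type*} [AddCommGroup V'] [Module ℂ V']
    [LieRingModule (GLie N) V'] [AddCommGroup V] [Module ℂ V] [LieRingModule (GLie N) V]
    (B : V' →ₗ⋆[ℂ] V →ₗ[ℂ] ℂ) : Prop :=
  ∀ (X : Matrix (Fin N) (Fin N) ℝ) (v' : V') (v : V),
    B ⁅(X.map (fun r : ℝ => (r : ℂ)) : GLie N), v'⁆ v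
      = -B v' ⁅(X.map (fun r : ℝ => (r : ℂ)) : GLie N), v⁆

/-- The diagonal matrix `exp (diag (t₁, …, t_N))` of the Cartan torus. -/
noncomputable def torusElt {N : ℕ} (t : Fin N → ℝ) : GLie N :=
  Matrix.diagonal fun k => ((Real.exp (t k) : ℝ) : ℂ)

/-- The action of the Cartan subalgebra on `V` is integrated to the action `π` of the Cartan torus
`{exp (diag t) : t ∈ ℝ^N}`, where `π t` stands for `e^{∑ t_k E_{kk}}`: the two actions are
compatible in the sense `h (X v) = (h X h⁻¹) (h v)`, and the matrix elements of the torus action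
against vectors of `V'` are differentiable at the unit element, the derivative in direction `s`
being given by the action of `∑ s_k E_{kk}`. -/
structure IsIntegratedCartan (N : ℕ) {V' V : Type*} [AddCommGroup V'] [Module ℂ V']
    [AddCommGroup V] [Module ℂ V] [LieRingModule (GLie N) V]
    (B : V' →ₗ⋆[ℂ] V →ₗ[ℂ] ℂ)
    (π : Representation ℂ (Multiplicative (Fin N → ℝ)) V) : Prop where
  adjoint_compat : ∀ (t : Fin N → ℝ) (X : GLie N) (v : V),
    π (Multiplicative.ofAdd t) ⁅X, v⁆
      = ⁅(torusElt t * X * torusElt (-t) : GLie N), π (Multiplicative.ofAdd t) v⁆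
  hasFDerivAt_zero : ∀ (v' : V') (v : V),
    HasFDerivAt (fun t : Fin N → ℝ => B v' (π (Multiplicative.ofAdd t) v))
      (∑ k : Fin N, (ContinuousLinearMap.proj k : (Fin N → ℝ) →L[ℝ] ℝ).smulRight
        (B v' ⁅(matUnit k k : GLie N), v⁆)) 0

/-- The matrix element `x ↦ e^{-x·ρ^{(N)}} ⟨w', e^{-∑ x_k E_{kk}} v⟩`. For Whittaker vectors
`w'` and `v = w` it is the Whittaker function `ψ`. -/
noncomputable def matrixElement {N : ℕ} {V' V : Type*} [AddCommGroup V'] [Module ℂ V']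
    [AddCommGroup V] [Module ℂ V]
    (B : V' →ₗ⋆[ℂ] V →ₗ[ℂ] ℂ)
    (π : Representation ℂ (Multiplicative (Fin N → ℝ)) V) (w' : V') (v : V)
    (x : Fin N → ℝ) : ℂ :=
  ((Real.exp (-∑ k, x k * rho N k) : ℝ) : ℂ) * B w' (π (Multiplicative.ofAdd (-x)) v)

/-! ### The operators of the open Toda chain from the monodromy matrix -/

/-- Smooth complex-valued functions of `x₁, …, x_N ∈ ℝ`. -/
def SmoothFun (N : ℕ) : Submodule ℂ ((Fin N → ℝ) → ℂ) where
  carrier := {f | ContDiff ℝ ∞ f}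
  add_mem' := fun {f g} (hf : ContDiff ℝ ∞ f) (hg : ContDiff ℝ ∞ g) => hf.add hg
  zero_mem' := (contDiff_const : ContDiff ℝ ∞ fun _ : Fin N → ℝ => (0 : ℂ))
  smul_mem' := fun c f (hf : ContDiff ℝ ∞ f) => hf.const_smul c

theorem smoothFun_contDiff {N : ℕ} (f : SmoothFun N) : ContDiff ℝ ∞ f.1 := f.2

theorem smoothFun_differentiableAt {N : ℕ} (f : SmoothFun N) (x : Fin N → ℝ) :
    DifferentiableAt ℝ f.1 x := ((smoothFun_contDiff f).differentiable (by simp)) x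

/-- The momentum operator `p_k = -iħ ∂/∂x_k`. -/
noncomputable def momentum {N : ℕ} (ħ : ℝ) (k : Fin N) : Module.End ℂ (SmoothFun N) where
  toFun f := ⟨fun x => -Complex.I * ħ * fderiv ℝ f.1 x (Pi.single k 1), by
    have h := ((smoothFun_contDiff f).fderiv_right (m := ∞) (by simp)).clm_apply
      (contDiff_const (c := (Pi.single k 1 : Fin N → ℝ)))
    have h' : ContDiff ℝ ∞ fun x : Fin N → ℝ =>
      -Complex.I * ħ * fderiv ℝ f.1 x (Pi.single k 1) := contDiff_const.mul h
    exact h'⟩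
  map_add' f g := by
    ext x
    have hf := smoothFun_differentiableAt f x
    have hg := smoothFun_differentiableAt g x
    simp [fderiv_add hf hg, mul_add]
  map_smul' c f := by
    ext x
    have hf := smoothFun_differentiableAt f x
    simp [fderiv_const_smul hf c]
    ring

/-- Multiplication by `e^{s x_k}`. -/
noncomputable def mulExp {N : ℕ} (s : ℝ) (k : Fin N) : Module.End ℂ (SmoothFun N) where
  toFun f := ⟨fun x => ((Real.exp (s * x k) : ℝ) : ℂ) * f.1 x, by
    have h : ContDiff ℝ ∞ (fun x : Fin N → ℝ => Real.exp (s * x k)) := by fun_prop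
    have h' : ContDiff ℝ ∞ fun x : Fin N → ℝ => ((Real.exp (s * x k) : ℝ) : ℂ) * f.1 x :=
      (Complex.ofRealCLM.contDiff.comp h).mul (smoothFun_contDiff f)
    exact h'⟩
  map_add' f g := by
    ext x
    simp [mul_add]
  map_smul' c f := by
    ext x
    simp
    ring

/-- The Lax operator `L_k(lam)`, with rows `(lam - p_k, e^{-x_k})` and `(-e^{x_k}, 0)`. -/
noncomputable def lax {N : ℕ} (ħ : ℝ) (lam : ℂ) (k : Fin N) :
    Matrix (Fin 2) (Fin 2) (Module.End ℂ (SmoothFun N)) :=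
  !![algebraMap ℂ (Module.End ℂ (SmoothFun N)) lam - momentum ħ k, mulExp (-1) k;
    -mulExp 1 k, 0]

/-- The monodromy matrix `T_n(lam) = L_n(lam) ⋯ L_1(lam)` of the first `n` sites, `n ≤ N`. -/
noncomputable def monodromy {N : ℕ} (ħ : ℝ) (lam : ℂ) :
    (n : ℕ) → n ≤ N → Matrix (Fin 2) (Fin 2) (Module.End ℂ (SmoothFun N))
  | 0, _ => 1
  | n + 1, h => lax ħ lam ⟨n, h⟩ * monodromy ħ lam n (Nat.le_of_succ_le h)

/-- `A_n(lam)`, the upper left entry of the monodromy matrix. -/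
noncomputable def todaA {N : ℕ} (ħ : ℝ) (lam : ℂ) (n : ℕ) (hn : n ≤ N) :
    Module.End ℂ (SmoothFun N) :=
  monodromy ħ lam n hn 0 0

/-! Both sides satisfy the same three-term recursion in `n`, namely `A_{m+2} = (λ - p_{m+2}) A_{m+1}
- e^{x_{m+1} - x_{m+2}} A_m`, with the same two initial values. On the Toda side it is read off from
the monodromy matrix (`todaA_add_two`).

On the Casimir side, the shift of the spectral parameter turns every `𝓐_n` into an upper left column
determinant of one fixed `N × N` matrix (`casimirGen_eq_colDet`). In the expansion along the last
column, the entries of that column act first on `w`. The Whittaker condition kills all of them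
except the diagonal one and the one just above it, which acts as `-1`
(`IsWhittakerUpper.principalDet_add_two`). The diagonal entry becomes `λ - p_{m+2}`, since
differentiating the matrix element produces `E_{kk}`, and differentiating the prefactor produces
`ρ^{(N)}_k` (`lam_sub_momentum_smoothElement`). The remaining minor equals `-iħ E_{m+2,m+1} 𝓐_m`
modulo a right ideal annihilated by `w'`, and `w'` turns that root vector into the Toda potential
(`matrixElement_shiftedDet`). -/

/-! ### Column determinants over a noncommutative algebra -/

/-- The column determinant of a square matrix with noncommuting entries; the factors of each
product are ordered by their columns. -/
def colDet {A : Type*} [Ring A] [Algebra ℂ A] {n : ℕ} (M : Fin n → Fin n → A) : A :=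
  ∑ p : Equiv.Perm (Fin n), ((Equiv.Perm.sign p : ℤ) : ℂ) • (List.ofFn fun k => M (p k) k).prod

/-- Expansion of a column determinant along the last column. -/
theorem colDet_succ {A : Type*} [Ring A] [Algebra ℂ A] {n : ℕ}
    (M : Fin (n + 1) → Fin (n + 1) → A) :
    colDet M = colDet (fun j k : Fin n => M j.castSucc k.castSucc) * M (Fin.last n) (Fin.last n)
      - ∑ i : Fin n, colDet (fun j k : Fin n =>
          M (Equiv.swap i.castSucc (Fin.last n) j.castSucc) k.castSucc)
            * M i.castSucc (Fin.last n) := by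
  -- A permutation is determined by the image of the last column (`none` when the last index is
  -- fixed) and a permutation of the first `n` indices, composed with a transposition. The
  -- transposition accounts for the sign `-1`.
  let e : Equiv.Perm (Fin (n + 1)) ≃ Option (Fin n) × Equiv.Perm (Fin n) :=
    (Equiv.permCongr finSuccEquivLast).trans Equiv.Perm.decomposeOption
  have hsign : ∀ i q, Equiv.Perm.sign (e.symm (i, q))
      = (if i = none then 1 else -1) * Equiv.Perm.sign q := by
    intro i q
    have : e.symm (i, q)
        = (Equiv.permCongr finSuccEquivLast).symm (Equiv.Perm.decomposeOption.symm (i, q)) := rfl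
    rw [this, Equiv.permCongr_symm, Equiv.Perm.sign_permCongr,
      Equiv.Perm.decomposeOption_symm_apply, Equiv.Perm.sign_mul, Equiv.optionCongr_sign]
    cases i <;> simp
  have happ : ∀ i q k, e.symm (i, q) k = finSuccEquivLast.symm
      (Equiv.swap none i ((finSuccEquivLast k).map q)) := by
    intro i q k
    rfl
  have hlast : ∀ i q, e.symm (i, q) (Fin.last n) = finSuccEquivLast.symm i := by
    intro i q
    simp [happ]
  have hcast : ∀ (i : Option (Fin n)) q (k : Fin n), e.symm (i, q) k.castSucc
      = Equiv.swap (finSuccEquivLast.symm i) (Fin.last n) (q k).castSucc := by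
    intro i q k
    rw [happ]
    have h1 : (finSuccEquivLast k.castSucc).map q = some (q k) := by simp
    rw [h1, Equiv.symm_apply_eq]
    cases i with
    | none => simp
    | some i =>
      by_cases h : q k = i
      · simp [h]
      · rw [Equiv.swap_apply_of_ne_of_ne (by simp) (by simpa using h),
          Equiv.swap_apply_of_ne_of_ne (by simpa using h) (Fin.castSucc_lt_last _).ne]
        simp
  unfold colDet
  rw [← e.symm.sum_comp, Fintype.sum_prod_type, Fintype.sum_option, sub_eq_add_neg]
  simp only [List.ofFn_succ', List.concat_eq_append, List.prod_append, List.prod_singleton,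
    hlast, hcast, hsign]
  congr 1
  · simp [Finset.sum_mul]
  · simp [Finset.sum_mul]

/-- If a right ideal is stable under left multiplication by the entries of a matrix and contains
all the entries of one row, then it contains the column determinant. -/
theorem colDet_mem {A : Type*} [Ring A] [Algebra ℂ A] {n : ℕ}
    (M : Fin n → Fin n → A) (R : Submodule ℂ A) (hR : ∀ a ∈ R, ∀ b, a * b ∈ R)
    (hM : ∀ j k, ∀ a ∈ R, M j k * a ∈ R) (i : Fin n) (hi : ∀ k, M i k ∈ R) :
    colDet M ∈ R := by
  have key : ∀ l : List A, (∀ m ∈ l, ∀ a ∈ R, m * a ∈ R) → (∃ m ∈ l, m ∈ R) → l.prod ∈ R := by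
    intro l
    induction l with
    | nil => simp
    | cons m l ih =>
      intro h1 h2
      rw [List.prod_cons]
      by_cases hm : m ∈ R
      · exact hR m hm _
      · refine h1 m (by simp) _ (ih (fun m' h => h1 m' (by simp [h])) ?_)
        obtain ⟨m', h, h'⟩ := h2
        rcases List.mem_cons.1 h with rfl | h
        · exact absurd h' hm
        · exact ⟨m', h, h'⟩
  refine R.sum_mem fun p _ => R.smul_mem _ (key _ ?_ ?_)
  · intro m hm
    obtain ⟨k, rfl⟩ := (List.mem_ofFn' _ _).1 hm
    exact hM _ _
  -- Every product meets row `i`, in column `p⁻¹ i`.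
  · refine ⟨M i (p.symm i), (List.mem_ofFn' _ _).2 ⟨p.symm i, by simp⟩, hi _⟩

/-- An element commuting with all the entries of a matrix commutes with its column determinant. -/
theorem colDet_commute {A : Type*} [Ring A] [Algebra ℂ A] {n : ℕ}
    (M : Fin n → Fin n → A) (a : A) (h : ∀ j k, Commute (M j k) a) :
    Commute (colDet M) a := by
  refine Commute.sum_left _ _ _ fun p _ => Commute.smul_left (Commute.list_prod_left _ _ ?_) _
  intro m hm
  obtain ⟨k, rfl⟩ := (List.mem_ofFn' _ _).1 hm
  exact h _ _

/-! ### The matrix of generators -/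

/-- The matrix with entries `(lam - iħ ρ^{(N)}_k) δ_{jk} - iħ E_{jk}`; the Casimir generating
functions are the column determinants of its upper left blocks. -/
noncomputable def genMatrix {N : ℕ} (ħ : ℝ) (lam : ℂ) (j k : Fin N) : UGL N :=
  (if j = k then algebraMap ℂ (UGL N) (lam - Complex.I * ħ * rho N k) else 0)
    - (Complex.I * ħ) • UniversalEnvelopingAlgebra.ι ℂ (matUnit j k)

/-- The difference `ρ^{(N)}_k - ρ^{(n)}_k = (N - n) / 2` does not depend on `k`, so the shift of `μ`
absorbs it and the determinants for different `n` become nested. -/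
theorem casimirGen_eq_colDet {N : ℕ} (n : ℕ) (hn : n ≤ N) (ħ : ℝ) (lam : ℂ) :
    casimirGen n hn ħ (lam - Complex.I * ((N : ℂ) - n) * ħ / 2)
      = colDet fun j k : Fin n => genMatrix ħ lam (Fin.castLE hn j) (Fin.castLE hn k) := by
  unfold casimirGen colDet genMatrix
  have h : ∀ k : Fin n, lam - Complex.I * ((N : ℂ) - n) * ħ / 2 - Complex.I * ħ * rho n k
      = lam - Complex.I * ħ * rho N (Fin.castLE hn k) := by
    intro k
    simp [rho]
    ring
  simp only [h, Fin.castLE_inj]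

theorem matUnit_lie {N : ℕ} (a b c d : Fin N) :
    ⁅(matUnit a b : GLie N), matUnit c d⁆
      = (if b = c then matUnit a d else 0) - if d = a then matUnit c b else 0 := by
  rw [LieRing.of_associative_ring_bracket]
  unfold matUnit
  congr 1
  · split_ifs with h
    · subst h; simp
    · simp [h]
  · split_ifs with h
    · subst h; simp
    · simp [h]

theorem genMatrix_of_ne {N : ℕ} (ħ : ℝ) (lam : ℂ) {j k : Fin N} (h : j ≠ k) :
    genMatrix ħ lam j k = -((Complex.I * ħ) • UniversalEnvelopingAlgebra.ι ℂ (matUnit j k)) := by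
  simp [genMatrix, h]

theorem genMatrix_mul_ι {N : ℕ} (ħ : ℝ) (lam : ℂ) (a b c d : Fin N) :
    genMatrix ħ lam a b * UniversalEnvelopingAlgebra.ι ℂ (matUnit c d)
      = UniversalEnvelopingAlgebra.ι ℂ (matUnit c d) * genMatrix ħ lam a b
        - (Complex.I * ħ) • UniversalEnvelopingAlgebra.ι ℂ
          ((if b = c then matUnit a d else 0) - if d = a then matUnit c b else 0) := by
  have h := congrArg (UniversalEnvelopingAlgebra.ι ℂ) (matUnit_lie a b c d)
  rw [LieHom.map_lie, LieRing.of_associative_ring_bracket, sub_eq_iff_eq_add] at h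
  have h2 : (if a = b then algebraMap ℂ (UGL N) (lam - Complex.I * ħ * rho N b) else 0)
        * UniversalEnvelopingAlgebra.ι ℂ (matUnit c d)
      = UniversalEnvelopingAlgebra.ι ℂ (matUnit c d)
        * (if a = b then algebraMap ℂ (UGL N) (lam - Complex.I * ħ * rho N b) else 0) := by
    split_ifs
    · exact Algebra.commutes _ _
    · simp
  rw [genMatrix, sub_mul, mul_sub, h2, smul_mul_assoc, mul_smul_comm, h, smul_add]
  abel

theorem genMatrix_commute {N : ℕ} (ħ : ℝ) (lam : ℂ) {a b c d : Fin N} (hbc : b ≠ c) (hda : d ≠ a) :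
    Commute (genMatrix ħ lam a b) (genMatrix ħ lam c d) := by
  have h : Commute (genMatrix ħ lam a b) (UniversalEnvelopingAlgebra.ι ℂ (matUnit c d)) := by
    have := genMatrix_mul_ι ħ lam a b c d
    rwa [if_neg hbc, if_neg hda, sub_zero, map_zero, smul_zero, sub_zero] at this
  refine Commute.sub_right ?_ (h.smul_right _)
  split_ifs
  · exact (Algebra.commutes _ _).symm
  · exact Commute.zero_right _

/-! ### Whittaker vectors -/

/-- On a common eigenvector the operators act by scalars, which commute. Since `E_{jk}` with `|j -
k| ≥ 2` is an iterated commutator of simple root vectors, it annihilates Whittaker vectors. -/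
theorem lie_lie_eq_zero_of_eigenvector {L W : Type*} [LieRing L] [LieAlgebra ℂ L]
    [AddCommGroup W] [Module ℂ W] [LieRingModule L W] [LieModule ℂ L W] {X Y : L} {w : W}
    {a b : ℂ} (hX : ⁅X, w⁆ = a • w) (hY : ⁅Y, w⁆ = b • w) : ⁅⁅X, Y⁆, w⁆ = 0 := by
  rw [lie_lie, hX, hY, lie_smul, lie_smul, hX, hY, smul_comm, sub_self]

theorem IsWhittakerLower.lie_eq_zero {N : ℕ} {ħ : ℝ} {V' : Type*} [AddCommGroup V']
    [Module ℂ V'] [LieRingModule (GLie N) V'] [LieModule ℂ (GLie N) V'] {w' : V'}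
    (h : IsWhittakerLower N ħ w') (j k : Fin N) (hjk : (k : ℕ) + 1 < j) :
    ⁅(matUnit j k : GLie N), w'⁆ = 0 := by
  obtain ⟨d, hd⟩ := Nat.exists_eq_add_of_lt hjk
  induction d generalizing k with
  | zero =>
    have h1 := h ⟨k + 1, by omega⟩ j (by simp; omega)
    have h2 := h k ⟨k + 1, by omega⟩ rfl
    have := lie_lie_eq_zero_of_eigenvector h1 h2
    rwa [matUnit_lie, if_pos rfl, if_neg (by omega), sub_zero] at this
  | succ d ih =>
    have h1 := ih ⟨k + 1, by omega⟩ (by simp; omega) (by simp; omega)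
    have h2 := h k ⟨k + 1, by omega⟩ rfl
    have := lie_lie_eq_zero_of_eigenvector (h1.trans (zero_smul ℂ w').symm) h2
    rwa [matUnit_lie, if_pos rfl, if_neg (by omega), sub_zero] at this

theorem IsWhittakerUpper.lie_eq_zero {N : ℕ} {ħ : ℝ} {V : Type*} [AddCommGroup V]
    [Module ℂ V] [LieRingModule (GLie N) V] [LieModule ℂ (GLie N) V] {w : V}
    (h : IsWhittakerUpper N ħ w) (j k : Fin N) (hjk : (j : ℕ) + 1 < k) :
    ⁅(matUnit j k : GLie N), w⁆ = 0 := by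
  obtain ⟨d, hd⟩ := Nat.exists_eq_add_of_lt hjk
  induction d generalizing j with
  | zero =>
    have h1 := h ⟨j + 1, by omega⟩ k (by simp; omega)
    have h2 := h j ⟨j + 1, by omega⟩ rfl
    have := lie_lie_eq_zero_of_eigenvector h2 h1
    rwa [matUnit_lie, if_pos rfl, if_neg (by omega), sub_zero] at this
  | succ d ih =>
    have h1 := ih ⟨j + 1, by omega⟩ (by simp; omega) (by simp; omega)
    have h2 := h j ⟨j + 1, by omega⟩ rfl
    have := lie_lie_eq_zero_of_eigenvector h2 (h1.trans (zero_smul ℂ w).symm)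
    rwa [matUnit_lie, if_pos rfl, if_neg (by omega), sub_zero] at this

theorem torusElt_conj_matUnit {N : ℕ} (t : Fin N → ℝ) (j k : Fin N) :
    torusElt t * matUnit j k * torusElt (-t) = ((Real.exp (t j - t k) : ℝ) : ℂ) • matUnit j k := by
  ext a b
  simp only [torusElt, matUnit, Matrix.mul_diagonal, Matrix.diagonal_mul, Matrix.smul_apply,
    Matrix.single_apply, smul_eq_mul]
  split_ifs with h
  · obtain ⟨rfl, rfl⟩ := h
    rw [sub_eq_add_neg, Real.exp_add]
    simp
  · simp

theorem uAct_ι {N : ℕ} {V : Type*} [AddCommGroup V] [Module ℂ V]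
    [LieRingModule (GLie N) V] [LieModule ℂ (GLie N) V] (X : GLie N) (v : V) :
    uAct (UniversalEnvelopingAlgebra.ι ℂ X) v = ⁅X, v⁆ := by
  simp only [uAct, UniversalEnvelopingAlgebra.lift_ι_apply, LieModule.toEnd_apply_apply]

theorem IsInvariantPairing.matUnit {N : ℕ} {V' V : Type*} [AddCommGroup V'] [Module ℂ V']
    [LieRingModule (GLie N) V'] [AddCommGroup V] [Module ℂ V] [LieRingModule (GLie N) V]
    {B : V' →ₗ⋆[ℂ] V →ₗ[ℂ] ℂ} (hB : IsInvariantPairing N B) (j k : Fin N) (v' : V') (v : V) :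
    B ⁅(matUnit j k : GLie N), v'⁆ v = -B v' ⁅(matUnit j k : GLie N), v⁆ := by
  have h := hB (Matrix.single j k 1) v' v
  have h1 : ((Matrix.single j k (1 : ℝ)).map (fun r : ℝ => (r : ℂ)) : GLie N)
      = _root_.matUnit j k := by
    ext a b
    simp only [Matrix.map_apply, _root_.matUnit, Matrix.single_apply]
    split_ifs <;> simp
  rwa [h1] at h

/-- Matrix elements as a linear function of the vector in `V`. -/
noncomputable def matrixElementₗ {N : ℕ} {V' V : Type*} [AddCommGroup V'] [Module ℂ V']
    [AddCommGroup V] [Module ℂ V] (B : V' →ₗ⋆[ℂ] V →ₗ[ℂ] ℂ)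
    (π : Representation ℂ (Multiplicative (Fin N → ℝ)) V) (w' : V') :
    V →ₗ[ℂ] (Fin N → ℝ) → ℂ where
  toFun := matrixElement B π w'
  map_add' v₁ v₂ := by
    ext x
    simp [matrixElement, mul_add]
  map_smul' c v := by
    ext x
    simp [matrixElement]
    ring

/-! ### Matrix elements as functions on the Cartan torus -/

section MatrixElements

variable {N : ℕ} {ħ : ℝ} {V' V : Type*} [AddCommGroup V'] [Module ℂ V']
  [LieRingModule (GLie N) V'] [LieModule ℂ (GLie N) V'] [AddCommGroup V] [Module ℂ V]
  [LieRingModule (GLie N) V] [LieModule ℂ (GLie N) V] {B : V' →ₗ⋆[ℂ] V →ₗ[ℂ] ℂ}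
  {π : Representation ℂ (Multiplicative (Fin N → ℝ)) V}

/-- Moving `E_{jk}` leftwards through the torus element rescales it by a root character; invariance
of the pairing then transfers it to `w'` with a sign. -/
theorem matrixElement_matUnit (hB : IsInvariantPairing N B) (hπ : IsIntegratedCartan N B π)
    (w' : V') (j k : Fin N) (v : V) (x : Fin N → ℝ) :
    matrixElement B π w' ⁅(matUnit j k : GLie N), v⁆ x
      = -((Real.exp (x k - x j) : ℝ) : ℂ)
        * matrixElement B π ⁅(matUnit j k : GLie N), w'⁆ v x := by
  unfold matrixElement
  rw [hπ.adjoint_compat, torusElt_conj_matUnit, smul_lie, map_smul, hB.matUnit]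
  have : (-x) j - (-x) k = x k - x j := by simp; ring
  rw [this, smul_eq_mul]
  ring

theorem matrixElement_matUnit_of_lt (hB : IsInvariantPairing N B)
    (hπ : IsIntegratedCartan N B π) {w' : V'} (hw' : IsWhittakerLower N ħ w') {j k : Fin N}
    (hjk : (k : ℕ) + 1 < j) (v : V) :
    matrixElement B π w' ⁅(matUnit j k : GLie N), v⁆ = 0 := by
  ext x
  rw [matrixElement_matUnit hB hπ, hw'.lie_eq_zero j k hjk]
  simp [matrixElement]

/-- Conjugate linearity in the first variable turns the eigenvalue `-iħ⁻¹` of `w'` into `iħ⁻¹`. -/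
theorem matrixElement_matUnit_of_succ (hB : IsInvariantPairing N B)
    (hπ : IsIntegratedCartan N B π) {w' : V'} (hw' : IsWhittakerLower N ħ w') {j k : Fin N}
    (hjk : (k : ℕ) + 1 = j) (v : V) (x : Fin N → ℝ) :
    matrixElement B π w' ⁅(matUnit j k : GLie N), v⁆ x
      = -(Complex.I * (ħ : ℂ)⁻¹) * ((Real.exp (x k - x j) : ℝ) : ℂ)
        * matrixElement B π w' v x := by
  rw [matrixElement_matUnit hB hπ, hw' k j hjk]
  simp [matrixElement]
  ring

theorem pairing_hasFDerivAt (hπ : IsIntegratedCartan N B π) (w' : V') (v : V) (x : Fin N → ℝ) :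
    HasFDerivAt (fun x : Fin N → ℝ => B w' (π (Multiplicative.ofAdd (-x)) v))
      (-∑ k : Fin N, (ContinuousLinearMap.proj k : (Fin N → ℝ) →L[ℝ] ℝ).smulRight
        (B w' (π (Multiplicative.ofAdd (-x)) ⁅(matUnit k k : GLie N), v⁆))) x := by
  have h := hπ.hasFDerivAt_zero w' (π (Multiplicative.ofAdd (-x)) v)
  have hk : ∀ k, ⁅(matUnit k k : GLie N), π (Multiplicative.ofAdd (-x)) v⁆
      = π (Multiplicative.ofAdd (-x)) ⁅(matUnit k k : GLie N), v⁆ := by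
    intro k
    rw [hπ.adjoint_compat, torusElt_conj_matUnit]
    simp
  simp only [hk] at h
  -- Differentiability at `0` is transported to `x` by the factorization `π(-y) = π(x - y) π(-x)`.
  have hs : HasFDerivAt (fun y : Fin N → ℝ => x - y) (-ContinuousLinearMap.id ℝ (Fin N → ℝ)) x :=
    (hasFDerivAt_id x).const_sub x
  have h0 : x - x = 0 := sub_self x
  rw [← h0] at h
  have h2 := h.comp x hs
  rw [ContinuousLinearMap.comp_neg, ContinuousLinearMap.comp_id] at h2
  refine h2.congr_of_eventuallyEq (.of_forall fun y => ?_)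
  simp only [Function.comp]
  rw [← Module.End.mul_apply, ← map_mul, ← ofAdd_add]
  congr 4
  abel

theorem matrixElement_hasFDerivAt (hπ : IsIntegratedCartan N B π) (w' : V') (v : V)
    (x : Fin N → ℝ) :
    HasFDerivAt (matrixElement B π w' v)
      (-∑ k : Fin N, (ContinuousLinearMap.proj k : (Fin N → ℝ) →L[ℝ] ℝ).smulRight
        (rho N k * matrixElement B π w' v x
          + matrixElement B π w' ⁅(matUnit k k : GLie N), v⁆ x)) x := by
  have h1 := pairing_hasFDerivAt hπ w' v x
  have h2 : HasFDerivAt (fun x : Fin N → ℝ => -∑ k, x k * rho N k)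
      (-∑ k : Fin N, rho N k • (ContinuousLinearMap.proj k : (Fin N → ℝ) →L[ℝ] ℝ)) x :=
    (HasFDerivAt.fun_sum fun k _ => (hasFDerivAt_apply k x).mul_const (rho N k)).neg
  have h3 := (Complex.ofRealCLM.hasFDerivAt.comp x h2.exp).mul h1
  refine h3.congr_fderiv ?_
  ext s
  simp only [matrixElement, Function.comp, add_apply,
    smul_apply, neg_apply, sum_apply,
    ContinuousLinearMap.smulRight_apply, ContinuousLinearMap.proj_apply,
    ContinuousLinearMap.comp_apply, Complex.ofRealCLM_apply, smul_eq_mul, Complex.real_smul,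
    Complex.ofReal_mul, Complex.ofReal_neg, Complex.ofReal_sum]
  simp only [mul_neg, Finset.mul_sum, ← neg_add, neg_inj,
    ← Finset.sum_add_distrib]
  refine Finset.sum_congr rfl fun k _ => ?_
  ring

/-- The derivative is again built from matrix elements, of the vectors `v` and `E_{kk} v`, so
regularity bootstraps; hence the induction is over all `v` at once. -/
theorem matrixElement_contDiff (hπ : IsIntegratedCartan N B π) (w' : V') (v : V) :
    ContDiff ℝ ∞ (matrixElement B π w' v) := by
  refine contDiff_infty.2 fun n => ?_
  induction n generalizing v with
  | zero =>
    exact contDiff_zero.2 (continuous_iff_continuousAt.2 fun x =>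
      (matrixElement_hasFDerivAt hπ w' v x).continuousAt)
  | succ n ih =>
    refine contDiff_succ_iff_hasFDerivAt.2 ⟨_, ?_, matrixElement_hasFDerivAt hπ w' v⟩
    refine (ContDiff.sum fun k _ => ?_).neg
    exact contDiff_const.smulRight ((contDiff_const.mul (ih v)).add (ih _))

/-- Matrix elements as smooth functions. -/
noncomputable def smoothElement (hπ : IsIntegratedCartan N B π) (w' : V') (v : V) :
    SmoothFun N := ⟨matrixElement B π w' v, matrixElement_contDiff hπ w' v⟩

theorem lam_sub_momentum_smoothElement (hπ : IsIntegratedCartan N B π) (w' : V') (v : V)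
    (lam : ℂ) (k : Fin N) :
    (algebraMap ℂ (Module.End ℂ (SmoothFun N)) lam - momentum ħ k) (smoothElement hπ w' v)
      = smoothElement hπ w' (uAct (genMatrix ħ lam k k) v) := by
  ext x
  have h := (matrixElement_hasFDerivAt hπ w' v x).fderiv
  have h1 : uAct (genMatrix ħ lam k k) v = (lam - Complex.I * ħ * rho N k) • v
      + (-(Complex.I * ħ)) • ⁅(matUnit k k : GLie N), v⁆ := by
    rw [genMatrix, if_pos rfl, map_sub, map_smul, AlgHom.commutes, LinearMap.sub_apply,
      LinearMap.smul_apply, uAct_ι, Module.algebraMap_end_apply, neg_smul, sub_eq_add_neg]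
  have h2 : matrixElement B π w' (uAct (genMatrix ħ lam k k) v)
      = (lam - Complex.I * ħ * rho N k) • matrixElement B π w' v
        + (-(Complex.I * ħ)) • matrixElement B π w' ⁅(matUnit k k : GLie N), v⁆ := by
    rw [h1]
    exact (map_add (matrixElementₗ B π w') _ _).trans
      (congrArg₂ _ (map_smul (matrixElementₗ B π w') _ _) (map_smul (matrixElementₗ B π w') _ _))
  simp only [smoothElement, h2]
  simp [momentum, h, Pi.single_apply, Finset.sum_add_distrib]
  ring

end MatrixElements

/-! ### The recursion for the Casimir generating functions -/

/-- The right ideal generated by the `E_{rj}` with `j < m`. -/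
noncomputable def lowerIdeal {N : ℕ} (r : Fin N) (m : ℕ) : Submodule ℂ (UGL N) :=
  Submodule.span ℂ {a | ∃ j : Fin N, (j : ℕ) < m ∧
    ∃ b, a = UniversalEnvelopingAlgebra.ι ℂ (matUnit r j) * b}

theorem ι_mul_mem_lowerIdeal {N : ℕ} {r : Fin N} {m : ℕ} {j : Fin N} (hj : (j : ℕ) < m)
    (b : UGL N) : UniversalEnvelopingAlgebra.ι ℂ (matUnit r j) * b ∈ lowerIdeal r m :=
  Submodule.subset_span ⟨j, hj, b, rfl⟩

theorem lowerIdeal_mul_mem {N : ℕ} {r : Fin N} {m : ℕ} {a : UGL N} (ha : a ∈ lowerIdeal r m)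
    (b : UGL N) : a * b ∈ lowerIdeal r m := by
  induction ha using Submodule.span_induction with
  | mem a h =>
    obtain ⟨j, hj, c, rfl⟩ := h
    rw [mul_assoc]
    exact ι_mul_mem_lowerIdeal hj _
  | zero => simp
  | add a₁ a₂ _ _ h₁ h₂ => rw [add_mul]; exact Submodule.add_mem _ h₁ h₂
  | smul c a _ h => rw [smul_mul_assoc]; exact Submodule.smul_mem _ _ h

theorem genMatrix_mem_lowerIdeal {N : ℕ} (ħ : ℝ) (lam : ℂ) {r : Fin N} {m : ℕ} {j : Fin N}
    (hj : (j : ℕ) < m) (hm : m ≤ r) : genMatrix ħ lam r j ∈ lowerIdeal r m := by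
  rw [genMatrix_of_ne ħ lam (by rintro rfl; omega)]
  have := ι_mul_mem_lowerIdeal (r := r) hj 1
  rw [mul_one] at this
  exact Submodule.neg_mem _ (Submodule.smul_mem _ _ this)

/-- The commutator of `E_{ab}` with `E_{rj}` is at most a multiple of the generator `E_{rb}`: its
other term needs `b = r`, excluded by `b < m ≤ r`. This lets a factor from row `r` be moved to the
far left, where it meets `w'`. -/
theorem genMatrix_mul_mem_lowerIdeal {N : ℕ} (ħ : ℝ) (lam : ℂ) {r : Fin N} {m : ℕ} {b : Fin N}
    (hb : (b : ℕ) < m) (hm : m ≤ r) (a : Fin N) {u : UGL N} (hu : u ∈ lowerIdeal r m) :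
    genMatrix ħ lam a b * u ∈ lowerIdeal r m := by
  induction hu using Submodule.span_induction with
  | mem u h =>
    obtain ⟨j, hj, c, rfl⟩ := h
    rw [← mul_assoc, genMatrix_mul_ι, if_neg (by rintro rfl; omega), zero_sub, map_neg, smul_neg,
      sub_neg_eq_add, add_mul, mul_assoc, smul_mul_assoc]
    refine Submodule.add_mem _ (ι_mul_mem_lowerIdeal hj _) (Submodule.smul_mem _ _ ?_)
    split_ifs
    · exact ι_mul_mem_lowerIdeal hb _
    · simp
  | zero => simp
  | add a₁ a₂ _ _ h₁ h₂ => rw [mul_add]; exact Submodule.add_mem _ h₁ h₂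
  | smul c a _ h => rw [mul_smul_comm]; exact Submodule.smul_mem _ _ h

/-- The column determinant of the upper left block of the matrix of generators. -/
noncomputable def principalDet {N : ℕ} (ħ : ℝ) (lam : ℂ) (n : ℕ) (hn : n ≤ N) : UGL N :=
  colDet fun j k : Fin n => genMatrix ħ lam (Fin.castLE hn j) (Fin.castLE hn k)

/-- The column determinant of rows `1, …, m, m + 2` and columns `1, …, m + 1`. -/
noncomputable def shiftedDet {N : ℕ} (ħ : ℝ) (lam : ℂ) (m : ℕ) (hm : m + 2 ≤ N) : UGL N :=
  colDet fun j k : Fin (m + 1) => genMatrix ħ lam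
    (Fin.castLE hm (Equiv.swap (Fin.last m).castSucc (Fin.last (m + 1)) j.castSucc))
    (Fin.castLE hm k.castSucc)

theorem principalDet_commute {N : ℕ} (ħ : ℝ) (lam : ℂ) (n : ℕ) (hn : n ≤ N) {c d : Fin N}
    (hc : n ≤ c) (hd : n ≤ d) :
    Commute (principalDet ħ lam n hn) (genMatrix ħ lam c d) := by
  refine colDet_commute _ _ fun j k => genMatrix_commute ħ lam ?_ ?_
  · rintro rfl
    simp at hc
    omega
  · rintro rfl
    simp at hd
    omega

/-- In the expansion along the last column, every term other than the leading one contains an `m ×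
m` determinant with columns `1, …, m` and a full row of index `m + 2`, so `colDet_mem` applies. The
leading term is reordered by `principalDet_commute`. -/
theorem shiftedDet_sub_mem_lowerIdeal {N : ℕ} (ħ : ℝ) (lam : ℂ) (m : ℕ) (hm : m + 2 ≤ N) :
    shiftedDet ħ lam m hm - genMatrix ħ lam ⟨m + 1, hm⟩ ⟨m, Nat.lt_of_succ_lt hm⟩
      * principalDet ħ lam m (by omega) ∈ lowerIdeal (⟨m + 1, hm⟩ : Fin N) m := by
  have hfix : ∀ j : Fin m,
      Equiv.swap (Fin.last m).castSucc (Fin.last (m + 1)) j.castSucc.castSucc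
        = j.castSucc.castSucc := by
    intro j
    refine Equiv.swap_apply_of_ne_of_ne ?_ (Fin.castSucc_lt_last _).ne
    rw [Ne, Fin.castSucc_inj]
    exact (Fin.castSucc_lt_last _).ne
  rw [shiftedDet, colDet_succ]
  simp only [hfix, Equiv.swap_apply_left]
  have h := principalDet_commute ħ lam m (by omega : m ≤ N) (c := ⟨m + 1, hm⟩)
    (d := ⟨m, Nat.lt_of_succ_lt hm⟩) (by simp) (by simp)
  rw [← h.eq]
  -- The leading terms differ only in how indices are embedded, so their equality is left to `rfl`.
  have h2 : ∀ X Y Z : UGL N, X = Z → X - Y - Z = -Y := by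
    intro X Y Z h
    rw [h]
    abel
  refine Set.mem_of_eq_of_mem (h2 _ _ _ rfl) ?_
  refine Submodule.neg_mem _ (Submodule.sum_mem _ fun i _ => lowerIdeal_mul_mem ?_ _)
  refine colDet_mem _ _ (fun a ha b => lowerIdeal_mul_mem ha b) (fun j k a ha => ?_) i
    (fun k => ?_)
  · exact genMatrix_mul_mem_lowerIdeal ħ lam (by simp) (by simp) _ ha
  · rw [Equiv.swap_apply_left, Equiv.swap_apply_left]
    exact genMatrix_mem_lowerIdeal ħ lam (by simp) (by simp)

/-! ### The common three-term recursion -/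

section Whittaker

variable {N : ℕ} {ħ : ℝ} {V' V : Type*} [AddCommGroup V'] [Module ℂ V']
  [LieRingModule (GLie N) V'] [LieModule ℂ (GLie N) V'] [AddCommGroup V] [Module ℂ V]
  [LieRingModule (GLie N) V] [LieModule ℂ (GLie N) V] {B : V' →ₗ⋆[ℂ] V →ₗ[ℂ] ℂ}
  {π : Representation ℂ (Multiplicative (Fin N → ℝ)) V}

theorem matrixElement_lowerIdeal (hB : IsInvariantPairing N B) (hπ : IsIntegratedCartan N B π)
    {w' : V'} (hw' : IsWhittakerLower N ħ w') (v : V) {r : Fin N} {m : ℕ} (hm : m < r)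
    {u : UGL N} (hu : u ∈ lowerIdeal r m) : matrixElement B π w' (uAct u v) = 0 := by
  change matrixElementₗ B π w' (uAct u v) = 0
  induction hu using Submodule.span_induction with
  | mem u h =>
    obtain ⟨j, hj, c, rfl⟩ := h
    rw [map_mul, Module.End.mul_apply, uAct_ι]
    exact matrixElement_matUnit_of_lt hB hπ hw' (j := r) (k := j) (by omega) _
  | zero => simp
  | add a₁ a₂ _ _ h₁ h₂ => simp [h₁, h₂]
  | smul c a _ h => simp [h]

theorem IsWhittakerUpper.principalDet_add_two (hħ : ħ ≠ 0) {w : V}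
    (hw : IsWhittakerUpper N ħ w) (lam : ℂ) (m : ℕ) (hm : m + 2 ≤ N) :
    uAct (principalDet (N := N) ħ lam (m + 2) hm) w
      = uAct (genMatrix ħ lam ⟨m + 1, hm⟩ ⟨m + 1, hm⟩)
          (uAct (principalDet (N := N) ħ lam (m + 1) (by omega)) w)
        + uAct (shiftedDet ħ lam m hm) w := by
  have hc : (ħ : ℂ) ≠ 0 := by exact_mod_cast hħ
  -- The entry just above the diagonal acts on `w` by `(-iħ)(-iħ⁻¹) = -1`, which cancels the sign of
  -- its cofactor.
  have h1 : uAct (genMatrix ħ lam (⟨m, Nat.lt_of_succ_lt hm⟩ : Fin N) ⟨m + 1, hm⟩) w = -w := by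
    rw [genMatrix_of_ne _ _ (by simp), map_neg, map_smul, LinearMap.neg_apply,
      LinearMap.smul_apply, uAct_ι, hw _ _ rfl, smul_smul]
    have : Complex.I * ħ * (-Complex.I * (ħ : ℂ)⁻¹) = 1 := by
      field_simp
      simp
    rw [this, one_smul]
  have h2 : ∀ i : Fin m, uAct (genMatrix ħ lam (Fin.castLE hm i.castSucc.castSucc)
      (Fin.castLE hm (Fin.last (m + 1)))) w = 0 := by
    intro i
    have hi : (i : ℕ) < m := i.2
    rw [genMatrix_of_ne _ _ (by simp [Fin.ext_iff]; omega), map_neg, map_smul,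
      LinearMap.neg_apply, LinearMap.smul_apply, uAct_ι, hw.lie_eq_zero _ _ (by simp), smul_zero,
      neg_zero]
  -- The expansion has the diagonal entry on the right; commuting it to the left matches the order
  -- of `λ - p_{m+2}` in the Toda recursion.
  have h3 := principalDet_commute ħ lam (m + 1) (by omega : m + 1 ≤ N) (c := ⟨m + 1, hm⟩)
    (d := ⟨m + 1, hm⟩) le_rfl le_rfl
  rw [← Module.End.mul_apply, ← map_mul, ← h3.eq]
  conv_lhs => rw [principalDet, colDet_succ, Fin.sum_univ_castSucc, map_sub, map_add, map_sum]
  simp only [map_mul, LinearMap.sub_apply, LinearMap.add_apply, LinearMap.sum_apply,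
    Module.End.mul_apply, h2, map_zero, Finset.sum_const_zero, zero_add]
  have h4 : uAct (genMatrix ħ lam (Fin.castLE hm (Fin.last m).castSucc)
      (Fin.castLE hm (Fin.last (m + 1)))) w = -w := h1
  rw [h4, map_neg, sub_neg_eq_add]
  rfl

theorem matrixElement_shiftedDet (hħ : ħ ≠ 0) (hB : IsInvariantPairing N B)
    (hπ : IsIntegratedCartan N B π) {w' : V'} (hw' : IsWhittakerLower N ħ w') (v : V) (lam : ℂ)
    (m : ℕ) (hm : m + 2 ≤ N) (x : Fin N → ℝ) :
    matrixElement B π w' (uAct (shiftedDet ħ lam m hm) v) x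
      = -((Real.exp (x ⟨m, Nat.lt_of_succ_lt hm⟩ - x ⟨m + 1, hm⟩) : ℝ) : ℂ)
        * matrixElement B π w' (uAct (principalDet (N := N) ħ lam m (by omega)) v) x := by
  have hc : (ħ : ℂ) ≠ 0 := by exact_mod_cast hħ
  have h := matrixElement_lowerIdeal hB hπ hw' v (by simp)
    (shiftedDet_sub_mem_lowerIdeal ħ lam m hm)
  rw [map_sub, LinearMap.sub_apply] at h
  have h1 := sub_eq_zero.1 ((map_sub (matrixElementₗ B π w') _ _).symm.trans h)
  refine (congrFun h1 x).trans ?_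
  rw [map_mul, Module.End.mul_apply, genMatrix_of_ne _ _ (by simp), map_neg, map_smul,
    LinearMap.neg_apply, LinearMap.smul_apply, uAct_ι, map_neg, map_smul, Pi.neg_apply,
    Pi.smul_apply]
  -- The constants combine to `(-iħ)(-iħ⁻¹) = -1`, leaving the bare potential.
  have h2 := matrixElement_matUnit_of_succ hB hπ hw' (j := ⟨m + 1, hm⟩)
    (k := ⟨m, Nat.lt_of_succ_lt hm⟩) rfl
    (uAct (principalDet (N := N) ħ lam m (by omega)) v) x
  refine (congrArg (fun z => -((Complex.I * ħ) • z)) h2).trans ?_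
  rw [smul_eq_mul]
  field_simp
  rw [Complex.I_sq]
  ring

/-- The zero in the Lax matrix makes the lower left monodromy entry equal to `-e^{x_{m+1}} A_m`,
which eliminates it from the recursion. -/
theorem todaA_add_two (ħ : ℝ) (lam : ℂ) (m : ℕ) (hm : m + 2 ≤ N) :
    todaA ħ lam (m + 2) hm
      = (algebraMap ℂ (Module.End ℂ (SmoothFun N)) lam - momentum ħ ⟨m + 1, hm⟩)
          * todaA ħ lam (m + 1) (by omega)
        - mulExp (-1) ⟨m + 1, hm⟩ * mulExp 1 ⟨m, Nat.lt_of_succ_lt hm⟩ * todaA ħ lam m (by omega) := by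
  have h1 : monodromy ħ lam (m + 1) (by omega : m + 1 ≤ N) 1 0
      = -mulExp 1 ⟨m, Nat.lt_of_succ_lt hm⟩ * todaA ħ lam m (by omega) := by
    rw [monodromy, Matrix.mul_apply, Fin.sum_univ_two]
    simp [lax, todaA]
  rw [todaA, monodromy, Matrix.mul_apply, Fin.sum_univ_two, h1]
  change (algebraMap ℂ (Module.End ℂ (SmoothFun N)) lam - momentum ħ ⟨m + 1, hm⟩)
      * todaA ħ lam (m + 1) (by omega) + mulExp (-1) ⟨m + 1, hm⟩
        * (-mulExp 1 ⟨m, Nat.lt_of_succ_lt hm⟩ * todaA ħ lam m (by omega)) = _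
  refine LinearMap.ext fun f => ?_
  have h2 := map_neg (mulExp (-1) (⟨m + 1, hm⟩ : Fin N))
    (mulExp 1 ⟨m, Nat.lt_of_succ_lt hm⟩ (todaA ħ lam m (by omega) f))
  exact (congrArg (_ + ·) h2).trans (sub_eq_add_neg _ _).symm

theorem todaA_smoothElement (hħ : ħ ≠ 0) (hB : IsInvariantPairing N B)
    (hπ : IsIntegratedCartan N B π) {w' : V'} (hw' : IsWhittakerLower N ħ w') {w : V}
    (hw : IsWhittakerUpper N ħ w) (lam : ℂ) (n : ℕ) (hn : n ≤ N) :
    todaA ħ lam n hn (smoothElement hπ w' w)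
      = smoothElement hπ w' (uAct (principalDet (N := N) ħ lam n hn) w) := by
  induction n using Nat.strong_induction_on with
  | _ n ih =>
    -- A second-order recursion needs the two base cases `n = 0` and `n = 1`.
    match n, ih, hn with
    | 0, _, _ => simp [todaA, monodromy, principalDet, colDet]
    | 1, _, hn =>
      have h1 : todaA ħ lam 1 hn
          = algebraMap ℂ (Module.End ℂ (SmoothFun N)) lam - momentum ħ ⟨0, hn⟩ := by
        simp [todaA, monodromy, lax]
      have h2 : principalDet (N := N) ħ lam 1 hn = genMatrix ħ lam ⟨0, hn⟩ ⟨0, hn⟩ := by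
        simp [principalDet, colDet]
        rfl
      rw [h1, h2, lam_sub_momentum_smoothElement]
    | m + 2, ih, hn =>
      rw [todaA_add_two, LinearMap.sub_apply, Module.End.mul_apply, Module.End.mul_apply,
        Module.End.mul_apply, ih (m + 1) (by omega), ih m (by omega),
        lam_sub_momentum_smoothElement, hw.principalDet_add_two hħ]
      ext x
      have h1 := matrixElement_shiftedDet hħ hB hπ hw' w lam m hn x
      have h2 := congrFun (map_add (matrixElementₗ B π w')
        (uAct (genMatrix ħ lam ⟨m + 1, hn⟩ ⟨m + 1, hn⟩)
          (uAct (principalDet (N := N) ħ lam (m + 1) (by omega)) w))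
        (uAct (shiftedDet ħ lam m hn) w)) x
      refine Eq.trans ?_ h2.symm
      rw [Pi.add_apply]
      refine Eq.trans ?_ (congrArg (_ + ·) h1.symm)
      simp only [Submodule.coe_sub, Pi.sub_apply, smoothElement, mulExp, LinearMap.coe_mk,
        AddHom.coe_mk, sub_eq_add_neg (x _), Real.exp_add]
      simp [matrixElementₗ]
      ring

end Whittaker

theorem proposition6p1 (N : ℕ) (ħ : ℝ) (hħ : ħ ≠ 0)
    {V' V : Type*} [AddCommGroup V'] [Module ℂ V'] [LieRingModule (GLie N) V']
    [LieModule ℂ (GLie N) V'] [AddCommGroup V] [Module ℂ V] [LieRingModule (GLie N) V]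
    [LieModule ℂ (GLie N) V]
    (B : V' →ₗ⋆[ℂ] V →ₗ[ℂ] ℂ) (hB : IsInvariantPairing N B)
    (π : Representation ℂ (Multiplicative (Fin N → ℝ)) V) (hπ : IsIntegratedCartan N B π)
    (w' : V') (hw' : IsWhittakerLower N ħ w') (w : V) (hw : IsWhittakerUpper N ħ w) :
    ∃ hψ : matrixElement B π w' w ∈ SmoothFun N,
      ∀ (n : ℕ) (hn : n ≤ N) (lam : ℂ) (x : Fin N → ℝ),
        (todaA ħ lam n hn ⟨matrixElement B π w' w, hψ⟩ : (Fin N → ℝ) → ℂ) x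
          = matrixElement B π w'
              (uAct (casimirGen n hn ħ (lam - Complex.I * ((N : ℂ) - n) * ħ / 2)) w) x := by
  refine ⟨matrixElement_contDiff hπ w' w, fun n hn lam x => ?_⟩
  rw [casimirGen_eq_colDet]
  exact congrFun (congrArg Subtype.val (todaA_smoothElement hħ hB hπ hw' hw lam n hn)) x
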